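/- Let $\mathcal{A}$ be a finite alphabet and let $X\subseteq\mathcal{A}^{\mathbb{Z}}$ be a subshift, that is, a closed subset (for the product of the discrete topologies) that is invariant under the shift $\sigma$ and its inverse, where $(\sigma x)_i = x_{i+1}$; no minimality or transitivity is assumed. For $n\in\mathbb{N}$ let $P_X(n)$ be the number of words $w=(w_0,\dots,w_{n-1})\in\mathcal{A}^n$ for which there is $x\in X$ with $x_i=w_i$ for all $0\le i<n$, and let $\mathrm{Aut}(X)$ be the group of all homeomorphisms $\varphi\colon X\to X$ with $\varphi\circ\sigma=\sigma\circ\varphi$. Suppose that $$P_X(n) = o\left(\frac{n^2}{\log^2 n}\right)\qquad (n\to\infty).$$ Then $\mathrm{Aut}(X)$ is amenable as a countable discrete group: it is countable, and there is a sequence $(F_k)_{k\in\mathbb{N}}$ of finite subsets of $\mathrm{Aut}(X)$ such that every $g\in\mathrm{Aut}(X)$ lies in all but finitely many $F_k$ and $$\lim_{k\to\infty}\frac{|F_k\,\triangle\, gF_k|}{|F_k|}=0\qquad\text{for every } g\in\mathrm{Aut}(X).$$ -/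

import Mathlib

open Filter Topology Asymptotics
open scoped Pointwise symmDiff
open SymbolicDynamics.FullShift (Subshift shift)

/-- The left shift `(σ x)_i = x_{i+1}`, as a homeomorphism of a two-sided subshift `X`. -/
def shiftHomeo {A : Type*} [TopologicalSpace A] (X : Subshift A ℤ) : X.carrier ≃ₜ X.carrier where
  toFun x := ⟨shift 1 x.1, X.mapsTo 1 x.2⟩
  invFun x := ⟨shift (-1) x.1, X.mapsTo (-1) x.2⟩
  left_inv x := by
    ext i
    simp
  right_inv x := by
    ext i
    simp
  continuous_toFun := by fun_prop
  continuous_invFun := by fun_prop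

/-- `Aut(X)`: the centralizer of the shift in the group of all self-homeomorphisms of `X`. -/
def Aut {A : Type*} [TopologicalSpace A] (X : Subshift A ℤ) : Subgroup (X.carrier ≃ₜ X.carrier) :=
  Subgroup.centralizer {shiftHomeo X}

/-- The cylinder `[w]₀⁺` of the bi-infinite sequences that read `w` at positions `0, …, n - 1`. -/
def wordCylinder {A : Type*} {n : ℕ} (w : Fin n → A) : Set (ℤ → A) :=
  {x | ∀ i : Fin n, x ((i : ℕ) : ℤ) = w i}

/-- The set `L_n(X)` of words of length `n` in the language of `X`. -/
def languageOfLength {A : Type*} [TopologicalSpace A] (X : Subshift A ℤ) (n : ℕ) :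
    Set (Fin n → A) :=
  {w | (wordCylinder w ∩ X.carrier).Nonempty}

/-- The word complexity `P_X(n)`, the number of words of length `n` in the language of `X`. -/
noncomputable def complexity {A : Type*} [TopologicalSpace A] (X : Subshift A ℤ) (n : ℕ) : ℕ :=
  (languageOfLength X n).ncard

/-- `F` is a Følner sequence for the discrete group `G`: the `F k` are finite, every element of `G`
lies in all but finitely many of them, and `|F k ∆ g F k| / |F k| → 0` for every `g`. -/
structure IsFolnerSequence {G : Type*} [Group G] (F : ℕ → Set G) : Prop where
  finite : ∀ k, (F k).Finite
  eventually_mem : ∀ g : G, ∀ᶠ k in atTop, g ∈ F k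
  tendsto_zero : ∀ g : G,
    Tendsto (fun k => ((F k ∆ (g • F k)).ncard : ℝ) / ((F k).ncard : ℝ)) atTop (𝓝 0)

/-- Amenability of a countable discrete group: it has a Følner sequence. -/
def IsAmenable (G : Type*) [Group G] : Prop :=
  Countable G ∧ ∃ F : ℕ → Set G, IsFolnerSequence F

/-!
Let `m` be large and `n ≥ 2 * m`. A right special word of length `n` is one that extends in two ways
to the right; between two of its visits to such words a point is determined by what it has read. An
automorphism `φ` of range `m` inherits this through its inverse: a window of `φ x` of length
`n + 4 * m`, starting where `x` reads a right special word, determines `φ x` up to the next right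
special word of `x`. The points that read no right special word at all are periodic. So `φ` is
determined by the windows of the images of finitely many test points, one for each extension of a
right special word and one for each shift orbit of the points without right special words, and the
number of automorphisms of range `m` is at most `P (n + 4 * m) ^ S`, where `P` is the complexity and
`S` the number of test points.

The extensions number at most `2 * (P (n + 1) - P n)`, which is at most `2 * P (3 * m) / m` for some
`n` between `2 * m` and `3 * m`. Two points of period at most `q` that read the same word of length
`2 * q` agree, so at most `P (4 * q) / q` orbits have a period in `[q, 2 * q)`. If `P (8 * q)` is at
most `η * q ^ 2` for all `q ≥ √m`, the sum over dyadic `q` between `√m` and `m` is a geometric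
series, and `S = O(η * m)`: unlike a bound on each dyadic block by `P (8 * m) / m`, this costs no
logarithm. When `P n = o(n ^ 2 / log n)` one may take `η = o(1 / log m)`, so that the number of
automorphisms of range `m` is `exp (o(m))`. The ranges add under composition, so suitable balls form
a Følner sequence.
-/

namespace SlowGrowth

open Set

/-! ### Periodic and eventually determined sequences -/

lemma eq_of_periodic_of_eqOn_Ico {α : Type*} {f g : ℤ → α} {p q : ℤ} (hp : 0 < p) (hq : 0 < q)
    (hf : Function.Periodic f p) (hg : Function.Periodic g q)
    (h : EqOn f g (Ico 0 (p + q))) : f = g := by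
  have hf' : ∀ t, f (t + p + q) = f (t + q) := fun t => by rw [add_right_comm, hf]
  suffices H : ∀ t, EqOn f g (Ico t (t + p + q)) from funext fun t => H t ⟨le_rfl, by omega⟩
  intro t
  induction t using Int.induction_on with
  | zero => simpa using h
  | succ t ih =>
    intro k hk
    rcases lt_or_ge k (t + p + q) with hlt | hge
    · exact ih ⟨by linarith [hk.1], hlt⟩
    obtain rfl : k = t + p + q := by have := hk.2; omega
    have h0 : f t = g t := ih ⟨le_rfl, by omega⟩
    have h1 : f (t + p) = g (t + p) := ih ⟨by omega, by omega⟩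
    have h2 : f (t + q) = g (t + q) := ih ⟨by omega, by omega⟩
    rw [hf', h2, hg, ← h0, ← hf, h1, hg]
  | pred t ih =>
    intro k hk
    rcases lt_or_ge k (-t) with hlt | hge
    · obtain rfl : k = -t - 1 := by have := hk.1; omega
      set u : ℤ := -t - 1
      have h1 : f (u + p) = g (u + p) := ih ⟨by omega, by omega⟩
      have h2 : f (u + q) = g (u + q) := ih ⟨by omega, by omega⟩
      have h3 : f (u + p + q) = g (u + p + q) := ih ⟨by omega, by omega⟩
      rw [← hf, h1, ← hg, ← h3, hf', h2, hg]
    · exact ih ⟨hge, by have := hk.2; omega⟩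

lemma exists_lt_eq_of_forall_lt {β : Type*} [Finite β] {s : ℤ → β} {k : ℤ}
    (h : ∀ i < k, ∀ j < k, s i = s j → s (i + 1) = s (j + 1)) : ∃ j < k, s j = s k := by
  obtain ⟨⟨i, hi⟩, ⟨j, hj⟩, hne, heq⟩ :=
    Finite.exists_ne_map_eq_of_infinite fun i : Iio k => s i
  wlog hij : i < j generalizing i j
  · exact this j hj i hi hne.symm heq.symm (by simp only [ne_eq, Subtype.mk.injEq] at hne; omega)
  have key : ∀ t ≥ j, t ≤ k → s (i + (t - j)) = s t := by
    intro t htj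
    induction t, htj using Int.leInduction with
    | base => simpa using fun _ => heq
    | succ t _ ih =>
      intro htk
      have := h _ (by simp only [mem_Iio] at hj; omega) t (by omega) (ih (by omega))
      rwa [add_assoc, sub_add_eq_add_sub] at this
  exact ⟨i + (k - j), by omega, key k (le_of_lt hj) le_rfl⟩

lemma eq_of_comp_eq_of_factorsThrough {α β : Type*} [Finite β] {w : α → β} {T : α → α}
    (hT : T.Surjective) (hw : (w ∘ T).FactorsThrough w) {x y : α} (h : w (T x) = w (T y)) :
    w x = w y := by
  have : Nonempty β := ⟨w x⟩
  obtain ⟨e, he⟩ := (Function.factorsThrough_iff _).1 hw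
  have himage : e '' range w = range w := by rw [← range_comp, ← he, hT.range_comp]
  refine injOn_of_ncard_image_eq (congrArg ncard himage) (toFinite _) ⟨x, rfl⟩ ⟨y, rfl⟩ ?_
  simpa [he] using (congrFun he x).symm.trans (h.trans (congrFun he y))

/-! ### Cardinalities of finite sets -/

lemma ncard_nonunique_add_le {α β : Type*} {W : Set α} (hW : W.Finite) (f : α → β) :
    {w ∈ W | ∃ w' ∈ W, w' ≠ w ∧ f w' = f w}.ncard + 2 * (f '' W).ncard ≤ 2 * W.ncard := by
  obtain ⟨V, hVW, hV⟩ := (surjOn_image f W).exists_bijOn_subset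
  have hVcard : V.ncard = (f '' W).ncard := by rw [← hV.image_eq, hV.injOn.ncard_image]
  have hcompl : (W \ V).ncard + V.ncard = W.ncard := ncard_sdiff_add_ncard_of_subset hVW hW
  have hshared : {v ∈ V | f v ∈ f '' (W \ V)}.ncard ≤ (W \ V).ncard :=
    (ncard_le_ncard_of_injOn f (fun _ hv => hv.2) (hV.injOn.mono (sep_subset _ _))
      (hW.sdiff.image f)).trans (ncard_image_le hW.sdiff)
  have hsub : {w ∈ W | ∃ w' ∈ W, w' ≠ w ∧ f w' = f w} ⊆
      (W \ V) ∪ {v ∈ V | f v ∈ f '' (W \ V)} := by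
    rintro w ⟨hw, w', hw', hne, hf⟩
    by_cases hwV : w ∈ V
    · exact Or.inr ⟨hwV, w', ⟨hw', fun h => hne (hV.injOn h hwV hf)⟩, hf⟩
    · exact Or.inl ⟨hw, hwV⟩
  have hle := (ncard_le_ncard hsub
    (hW.sdiff.union ((hW.subset hVW).subset (sep_subset _ _)))).trans (ncard_union_le _ _)
  omega

lemma ncard_symmDiff_add_ncard_add_ncard_le {α : Type*} {s t u : Set α} (hu : u.Finite)
    (hs : s ⊆ u) (ht : t ⊆ u) : (s ∆ t).ncard + (s.ncard + t.ncard) ≤ 2 * u.ncard := by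
  have hsub : s ∆ t ⊆ (u \ t) ∪ (u \ s) := by
    rintro x (⟨hx, hx'⟩ | ⟨hx, hx'⟩)
    · exact Or.inl ⟨hs hx, hx'⟩
    · exact Or.inr ⟨ht hx, hx'⟩
  have hle := (ncard_le_ncard hsub (hu.sdiff.union hu.sdiff)).trans (ncard_union_le _ _)
  have hcs := ncard_sdiff_add_ncard_of_subset hs hu
  have hct := ncard_sdiff_add_ncard_of_subset ht hu
  omega

lemma ncard_lt_two_pow_le {α : Type*} {T : Set α} (hT : T.Finite) {f : α → ℕ} {η : ℝ} {a b : ℕ}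
    (hab : a ≤ b)
    (h : ∀ k ≥ a, ({y ∈ T | 2 ^ k ≤ f y ∧ f y < 2 ^ (k + 1)}.ncard : ℝ) ≤ η * 2 ^ k) :
    ({y ∈ T | f y < 2 ^ b}.ncard : ℝ) ≤
      {y ∈ T | f y < 2 ^ a}.ncard + η * (2 ^ b - 2 ^ a) := by
  induction b, hab using Nat.le_induction with
  | base => simp
  | succ k hk ih =>
    have hsub : {y ∈ T | f y < 2 ^ (k + 1)} ⊆
        {y ∈ T | f y < 2 ^ k} ∪ {y ∈ T | 2 ^ k ≤ f y ∧ f y < 2 ^ (k + 1)} := fun y ⟨hy, hlt⟩ =>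
      (lt_or_ge (f y) (2 ^ k)).imp (fun h => ⟨hy, h⟩) fun h => ⟨hy, h, hlt⟩
    have hle : ({y ∈ T | f y < 2 ^ (k + 1)}.ncard : ℝ) ≤ {y ∈ T | f y < 2 ^ k}.ncard +
        {y ∈ T | 2 ^ k ≤ f y ∧ f y < 2 ^ (k + 1)}.ncard := by
      exact_mod_cast (ncard_le_ncard hsub
        ((hT.sep _).union (hT.sep _))).trans (ncard_union_le _ _)
    rw [pow_succ (2 : ℝ)]
    linarith [h k hk]

/-! ### Words -/

section Words

variable {A : Type*} [TopologicalSpace A] {X : Subshift A ℤ} {x y : X.carrier} {n : ℕ}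

/-- The action of `ℤ` on a subshift by powers of the left shift: `(k +ᵥ x) i = x (k + i)`. -/
instance shiftAction : AddAction ℤ X.carrier where
  vadd k x := ⟨shift k x.1, X.mapsTo k x.2⟩
  zero_vadd x := by ext i; exact congrArg x.1 (zero_add i)
  add_vadd k l x := by ext i; exact congrArg x.1 (by ring)

@[simp]
lemma vadd_apply (k : ℤ) (x : X.carrier) (i : ℤ) : (k +ᵥ x).1 i = x.1 (k + i) := rfl

lemma vadd_eq_self_iff_periodic {p : ℤ} : p +ᵥ x = x ↔ Function.Periodic x.1 p := by
  simp only [Subtype.ext_iff, funext_iff, vadd_apply, Function.Periodic, add_comm p]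

lemma vadd_eq_self_iff_period_dvd {k : ℤ} :
    k +ᵥ x = x ↔ (AddAction.period (1 : ℤ) x : ℤ) ∣ k := by
  rw [← AddAction.zsmul_vadd_eq_iff_period_dvd, smul_eq_mul, mul_one]

/-- The word of length `n` that a point of a subshift reads from position `0` on; the word it reads
from position `i` on is `word n (i +ᵥ x)`. -/
def word (n : ℕ) (x : X.carrier) : Fin n → A := fun k => x.1 (k : ℕ)

lemma word_eq_word_iff : word n x = word n y ↔ EqOn x.1 y.1 (Ico 0 n) := by
  refine ⟨fun h k hk => ?_, fun h => funext fun k => h (mem_Ico.2 ⟨by omega, by omega⟩)⟩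
  lift k to ℕ using hk.1
  exact congrFun h ⟨k, by simpa using hk.2⟩

lemma word_vadd_eq_iff_eqOn {i : ℤ} :
    word n (i +ᵥ x) = word n (i +ᵥ y) ↔ EqOn x.1 y.1 (Ico i (i + n)) := by
  refine word_eq_word_iff.trans ⟨fun h k hk => ?_, fun h k hk => ?_⟩
  · simpa using h (x := k - i) ⟨by linarith [hk.1], by linarith [hk.2]⟩
  · exact h (x := i + k) (mem_Ico.2 ⟨by linarith [hk.1], by linarith [hk.2]⟩)

lemma word_one_vadd_eq_of_word_succ_eq (h : word (n + 1) x = word (n + 1) y) :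
    word n ((1 : ℤ) +ᵥ x) = word n ((1 : ℤ) +ᵥ y) :=
  word_vadd_eq_iff_eqOn.2 <| (word_eq_word_iff.1 h).mono fun k hk =>
    mem_Ico.2 ⟨by linarith [hk.1], by push_cast; linarith [hk.2]⟩

lemma range_word (X : Subshift A ℤ) (n : ℕ) :
    range (word n : X.carrier → Fin n → A) = languageOfLength X n := by
  ext w
  refine ⟨?_, fun ⟨x, hxw, hx⟩ => ⟨⟨x, hx⟩, funext hxw⟩⟩
  rintro ⟨x, rfl⟩
  exact ⟨x, fun _ => rfl, x.2⟩

lemma init_image_languageOfLength (X : Subshift A ℤ) (n : ℕ) :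
    (fun w : Fin (n + 1) → A => Fin.init w) '' languageOfLength X (n + 1) =
      languageOfLength X n := by
  rw [← range_word, ← range_word, ← range_comp]
  rfl

variable [Finite A]

lemma complexity_mono : Monotone (complexity X) := monotone_nat_of_le_succ fun n => by
  rw [complexity, ← init_image_languageOfLength]
  exact ncard_image_le (toFinite _)

lemma ncard_le_complexity_of_injOn {U : Set X.carrier} (h : InjOn (word n) U) :
    U.ncard ≤ complexity X n :=
  ncard_le_ncard_of_injOn (word n) (fun x _ => range_word X n ▸ mem_range_self x) h (toFinite _)

end Words

/-! ### Right special words and deterministic points -/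

section RightSpecial

variable {A : Type*} [TopologicalSpace A] {X : Subshift A ℤ} {x y : X.carrier} {n : ℕ}

/-- The word of length `n` read by `x` at position `0` is right special: the language of `X`
contains a one-letter extension of it to the right that differs from the one read by `x`. -/
def RightSpecial (n : ℕ) (x : X.carrier) : Prop :=
  ∃ y : X.carrier, word n y = word n x ∧ word (n + 1) y ≠ word (n + 1) x

lemma word_succ_eq_of_not_rightSpecial (hx : ¬ RightSpecial n x) (h : word n x = word n y) :
    word (n + 1) x = word (n + 1) y :=
  by_contra fun hne => hx ⟨y, h.symm, Ne.symm hne⟩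

lemma RightSpecial.congr (h : word n x = word n y) (hx : RightSpecial n x) : RightSpecial n y := by
  by_contra hy
  obtain ⟨z, hz, hne⟩ := hx
  have hyx := word_succ_eq_of_not_rightSpecial hy h.symm
  have hyz := word_succ_eq_of_not_rightSpecial hy (h.symm.trans hz.symm)
  exact hne (hyz.symm.trans hyx)

lemma word_one_vadd_eq_of_not_rightSpecial (hx : ¬ RightSpecial n x) (h : word n x = word n y) :
    word n ((1 : ℤ) +ᵥ x) = word n ((1 : ℤ) +ᵥ y) :=
  word_one_vadd_eq_of_word_succ_eq (word_succ_eq_of_not_rightSpecial hx h)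

lemma eqOn_of_not_rightSpecial {a b : ℤ} (h : EqOn x.1 y.1 (Ico a (a + n)))
    (hx : ∀ j ∈ Icc a b, ¬ RightSpecial n (j +ᵥ x)) : EqOn x.1 y.1 (Icc a (b + n)) := by
  have key : ∀ j ≥ a, j ≤ b → word (n + 1) (j +ᵥ x) = word (n + 1) (j +ᵥ y) := by
    intro j hj hjb
    refine word_succ_eq_of_not_rightSpecial (hx j ⟨hj, hjb⟩) ?_
    induction j, hj using Int.leInduction with
    | base => exact word_vadd_eq_iff_eqOn.2 h
    | succ j hj ih =>
      have := word_one_vadd_eq_of_not_rightSpecial (hx j ⟨hj, by omega⟩) (ih (by omega))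
      rwa [vadd_vadd, vadd_vadd, add_comm] at this
  intro k ⟨hak, hkb⟩
  rcases lt_or_ge k (a + n) with hk | hk
  · exact h ⟨hak, hk⟩
  · have hword := word_vadd_eq_iff_eqOn.1 (key (k - n) (by omega) (by omega))
    exact hword (x := k) ⟨by omega, by push_cast; omega⟩

/-- The points that read no right special word of length `n` at any position. -/
def deterministicPoints (X : Subshift A ℤ) (n : ℕ) : Set X.carrier :=
  {x | ∀ j : ℤ, ¬ RightSpecial n (j +ᵥ x)}

lemma vadd_mem_deterministicPoints (k : ℤ) (hx : x ∈ deterministicPoints X n) :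
    k +ᵥ x ∈ deterministicPoints X n := fun j => by
  rw [vadd_vadd]
  exact hx _

lemma not_rightSpecial_of_mem_deterministicPoints (hx : x ∈ deterministicPoints X n) :
    ¬ RightSpecial n x := by
  simpa using hx 0

variable [Finite A]

lemma mem_deterministicPoints_of_forall_le {b : ℤ}
    (hb : ∀ j ≤ b, ¬ RightSpecial n (j +ᵥ x)) : x ∈ deterministicPoints X n := by
  by_contra hx
  obtain ⟨k, hk, hmin⟩ := Int.exists_least_of_bdd
    ⟨b, fun j hj => (not_le.1 fun hjb => hb j hjb hj).le⟩ (not_forall_not.1 hx)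
  have hfree : ∀ j < k, ¬ RightSpecial n (j +ᵥ x) := fun j hj h => hj.not_ge (hmin j h)
  obtain ⟨j, hjk, heq⟩ := exists_lt_eq_of_forall_lt (s := fun j => word n (j +ᵥ x)) (k := k)
    fun i hi j _ hij => by
      simpa only [vadd_vadd, add_comm] using word_one_vadd_eq_of_not_rightSpecial (hfree i hi) hij
  exact hfree j hjk (hk.congr heq.symm)

lemma injOn_word_deterministicPoints (X : Subshift A ℤ) (n : ℕ) :
    InjOn (word n) (deterministicPoints X n) := by
  intro x hx y hy hxy
  let D := deterministicPoints X n
  let σ (k : ℤ) (z : D) : D := ⟨k +ᵥ z.1, vadd_mem_deterministicPoints k z.2⟩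
  have hσ : (σ 1).Surjective := fun z => ⟨σ (-1) z, by simp [σ]⟩
  have hfactors : ((word n ∘ Subtype.val) ∘ σ 1).FactorsThrough (word n ∘ Subtype.val) :=
    fun z _ h => word_one_vadd_eq_of_not_rightSpecial
      (not_rightSpecial_of_mem_deterministicPoints z.2) h
  have key : ∀ j : ℤ, word n (j +ᵥ x) = word n (j +ᵥ y) := by
    intro j
    induction j using Int.induction_on with
    | zero => simpa using hxy
    | succ j ih =>
      simpa only [vadd_vadd, add_comm] using word_one_vadd_eq_of_not_rightSpecial (hx j) ih
    | pred j ih =>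
      refine eq_of_comp_eq_of_factorsThrough hσ hfactors (x := σ (-j - 1) ⟨x, hx⟩)
        (y := σ (-j - 1) ⟨y, hy⟩) ?_
      simpa [σ, vadd_vadd] using ih
  ext j
  have hj := word_succ_eq_of_not_rightSpecial (hx j) (key j)
  simpa [word] using congrFun hj 0

lemma finite_deterministicPoints (X : Subshift A ℤ) (n : ℕ) : (deterministicPoints X n).Finite :=
  .of_injOn (mapsTo_univ _ _) (injOn_word_deterministicPoints X n) finite_univ

lemma period_pos_of_mem_deterministicPoints (hx : x ∈ deterministicPoints X n) :
    0 < AddAction.period (1 : ℤ) x := by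
  have := (finite_deterministicPoints X n).to_subtype
  obtain ⟨i, j, hne, heq⟩ := Finite.exists_ne_map_eq_of_infinite fun k : ℤ =>
    (⟨k +ᵥ x, vadd_mem_deterministicPoints k hx⟩ : deterministicPoints X n)
  have hfix : (i - j) +ᵥ x = x := by
    rw [sub_eq_neg_add, ← vadd_vadd, show i +ᵥ x = j +ᵥ x from congrArg Subtype.val heq,
      neg_vadd_vadd]
  refine Nat.pos_of_ne_zero fun h0 => hne ?_
  rw [vadd_eq_self_iff_period_dvd, h0, Nat.cast_zero, zero_dvd_iff] at hfix
  omega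

end RightSpecial

/-! ### Automorphisms of bounded range -/

section Range

variable {A : Type*} [TopologicalSpace A] {X : Subshift A ℤ}

lemma aut_vadd (g : Aut X) (k : ℤ) (x : X.carrier) : g.1 (k +ᵥ x) = k +ᵥ g.1 x := by
  have hone (y : X.carrier) : g.1 ((1 : ℤ) +ᵥ y) = (1 : ℤ) +ᵥ g.1 y :=
    DFunLike.congr_fun (Subgroup.mem_centralizer_singleton_iff.1 g.2) y
  induction k using Int.induction_on generalizing x with
  | zero => simp
  | succ k ih => rw [← vadd_vadd, ih, hone, vadd_vadd]
  | pred k ih =>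
    rw [← vadd_left_cancel_iff (1 : ℤ), ← hone, vadd_vadd, vadd_vadd, add_sub_cancel, ih]

lemma aut_inv_apply_self (g : Aut X) (x : X.carrier) : (g⁻¹).1 (g.1 x) = x :=
  g.1.symm_apply_apply x

lemma aut_apply_inv_self (g : Aut X) (x : X.carrier) : g.1 ((g⁻¹).1 x) = x :=
  g.1.apply_symm_apply x

lemma aut_ext_zero {g h : Aut X} (H : ∀ x : X.carrier, (g.1 x).1 0 = (h.1 x).1 0) : g = h := by
  ext x t
  simpa [aut_vadd] using H (t +ᵥ x)

/-- `f` is a sliding block code of range `m`: the letter of `f x` at position `t` depends only on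
the letters of `x` at positions `t - m, …, t + m`. -/
def HasRange (f : X.carrier → X.carrier) (m : ℕ) : Prop :=
  ∀ (x y : X.carrier) (t : ℤ), EqOn x.1 y.1 (Icc (t - m) (t + m)) → (f x).1 t = (f y).1 t

section HasRange

variable {f g : X.carrier → X.carrier} {m m' : ℕ}

lemma HasRange.id (m : ℕ) : HasRange (id : X.carrier → X.carrier) m :=
  fun _ _ _ hxy => hxy ⟨by omega, by omega⟩

lemma HasRange.mono (hf : HasRange f m) (h : m ≤ m') : HasRange f m' :=
  fun x y t hxy => hf x y t (hxy.mono (Icc_subset_Icc (by omega) (by omega)))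

lemma HasRange.comp (hf : HasRange f m) (hg : HasRange g m') : HasRange (f ∘ g) (m + m') :=
  fun x y t hxy => hf _ _ t fun k hk => hg x y k <| hxy.mono <|
    Icc_subset_Icc (by have := hk.1; omega) (by have := hk.2; omega)

lemma HasRange.eqOn (hf : HasRange f m) {x y : X.carrier} {a b : ℤ}
    (h : EqOn x.1 y.1 (Icc a b)) : EqOn (f x).1 (f y).1 (Icc (a + m) (b - m)) :=
  fun t ht => hf x y t <| h.mono <|
    Icc_subset_Icc (by linarith [ht.1]) (by linarith [ht.2])

end HasRange

lemma continuous_eval (i : ℤ) : Continuous fun x : X.carrier => x.1 i :=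
  (continuous_apply i).comp continuous_subtype_val

lemma exists_forall_eqOn_imp_eq [CompactSpace A] [T2Space A] {B : Type*} [TopologicalSpace B]
    [DiscreteTopology B] {f : X.carrier → B} (hf : Continuous f) :
    ∃ m : ℕ, ∀ x y : X.carrier, EqOn x.1 y.1 (Icc (-m) m) → f x = f y := by
  have : CompactSpace X.carrier := isCompact_iff_compactSpace.1 X.isClosed.isCompact
  let K (m : ℕ) : Set (X.carrier × X.carrier) :=
    {p | EqOn p.1.1 p.2.1 (Icc (-m) m) ∧ f p.1 ≠ f p.2}
  have hclosed (m : ℕ) : IsClosed (K m) := by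
    refine .inter ?_ ((isClosed_discrete {q : B × B | q.1 ≠ q.2}).preimage
      (hf.prodMap hf))
    change IsClosed {p : X.carrier × X.carrier | ∀ i, i ∈ Icc (-m : ℤ) m → p.1.1 i = p.2.1 i}
    simp only [ofPred_forall]
    exact isClosed_iInter fun i => isClosed_iInter fun _ => isClosed_eq
      ((continuous_eval i).comp continuous_fst) ((continuous_eval i).comp continuous_snd)
  have hanti (m : ℕ) : K (m + 1) ⊆ K m := fun p hp =>
    ⟨hp.1.mono (Icc_subset_Icc (by omega) (by omega)), hp.2⟩
  by_contra! hK
  have hne (m : ℕ) : (K m).Nonempty := let ⟨x, y, h⟩ := hK m; ⟨(x, y), h⟩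
  obtain ⟨⟨x, y⟩, hxy⟩ := IsCompact.nonempty_iInter_of_sequence_nonempty_isCompact_isClosed K
    hanti hne (hclosed 0).isCompact hclosed
  rw [mem_iInter] at hxy
  refine (hxy 0).2 (congrArg f (Subtype.ext (funext fun t => (hxy t.natAbs).1 ?_)))
  exact ⟨by omega, by omega⟩

lemma exists_hasRange [Finite A] [DiscreteTopology A] (g : Aut X) : ∃ m, HasRange g.1 m := by
  obtain ⟨m, hm⟩ := exists_forall_eqOn_imp_eq ((continuous_eval 0).comp g.1.continuous)
  refine ⟨m, fun x y t hxy => ?_⟩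
  have := hm (t +ᵥ x) (t +ᵥ y) fun k hk => hxy (x := t + k) ⟨by linarith [hk.1], by linarith [hk.2]⟩
  simpa [Function.comp_def, aut_vadd] using this

/-- The automorphisms that are, together with their inverses, sliding block codes of range `m`.
They exhaust `Aut X` as `m` grows and play the role of the balls of a length function. -/
def autOfRange (X : Subshift A ℤ) (m : ℕ) : Set (Aut X) :=
  {g | HasRange g.1 m ∧ HasRange (g⁻¹).1 m}

lemma one_mem_autOfRange (m : ℕ) : (1 : Aut X) ∈ autOfRange X m :=
  ⟨.id m, inv_one (G := Aut X) ▸ .id m⟩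

lemma autOfRange_mono : Monotone (autOfRange X) :=
  fun _ _ h _ hg => ⟨hg.1.mono h, hg.2.mono h⟩

lemma mul_mem_autOfRange {g h : Aut X} {a b : ℕ} (hg : g ∈ autOfRange X a)
    (hh : h ∈ autOfRange X b) : g * h ∈ autOfRange X (a + b) := by
  refine ⟨hg.1.comp hh.1, ?_⟩
  rw [mul_inv_rev, add_comm]
  exact hh.2.comp hg.2

lemma exists_mem_autOfRange [Finite A] [DiscreteTopology A] (g : Aut X) :
    ∃ m, g ∈ autOfRange X m := by
  obtain ⟨a, ha⟩ := exists_hasRange g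
  obtain ⟨b, hb⟩ := exists_hasRange g⁻¹
  exact ⟨max a b, ha.mono (le_max_left _ _), hb.mono (le_max_right _ _)⟩

end Range

/-! ### Test sets -/

section TestSet

variable {A : Type*} [TopologicalSpace A] {X : Subshift A ℤ} {m n : ℕ} {φ ψ : Aut X}
  {x : X.carrier} {S : Set X.carrier}

lemma eqOn_aut_of_not_rightSpecial (hφ : φ ∈ autOfRange X m) {a b : ℤ}
    (h : EqOn (φ.1 x).1 (ψ.1 x).1 (Ico a (a + n + 2 * m)))
    (hx : ∀ j ∈ Icc (a + m) b, ¬ RightSpecial n (j +ᵥ x)) :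
    EqOn (φ.1 x).1 (ψ.1 x).1 (Icc a (b + n - m)) := by
  set z : X.carrier := (φ⁻¹).1 (ψ.1 x)
  have hφz : φ.1 z = ψ.1 x := aut_apply_inv_self φ _
  have hxz : EqOn x.1 z.1 (Ico (a + m) (a + m + n)) := by
    have := hφ.2.eqOn (h.mono fun k (hk : k ∈ Icc a (a + n + 2 * m - 1)) =>
      mem_Ico.2 ⟨hk.1, by have := hk.2; omega⟩)
    rw [aut_inv_apply_self] at this
    exact this.mono fun k hk => mem_Icc.2 ⟨hk.1, by have := hk.2; omega⟩
  have hφxz := hφ.1.eqOn (eqOn_of_not_rightSpecial hxz hx)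
  rw [hφz] at hφxz
  intro k ⟨hak, hkb⟩
  rcases lt_or_ge k (a + n + 2 * m) with hk | hk
  · exact h ⟨hak, hk⟩
  · exact hφxz ⟨by omega, hkb⟩

/-- `S` is a set of test points of order `n`: every right special word of length `n`, followed by
any letter allowed after it, is read by a point of `S` at position `0`, and `S` meets every shift
orbit of points that read no right special word of length `n`. -/
structure IsTestSet (n : ℕ) (S : Set X.carrier) : Prop where
  edges : ∀ x : X.carrier, RightSpecial n x → ∃ s ∈ S, word (n + 1) s = word (n + 1) x
  orbits : ∀ x ∈ deterministicPoints X n, ∃ k : ℤ, k +ᵥ x ∈ S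

lemma IsTestSet.eqOn_of_rightSpecial (hS : IsTestSet n S) (hm : 0 < m)
    (hφ : φ ∈ autOfRange X m) (hψ : ψ ∈ autOfRange X m)
    (h : ∀ s ∈ S, EqOn (φ.1 s).1 (ψ.1 s).1 (Ico 0 (n + 4 * m)))
    (h0 : RightSpecial n x) {N : ℤ} (hx : ∀ j ∈ Icc 1 N, ¬ RightSpecial n (j +ᵥ x)) :
    EqOn (φ.1 x).1 (ψ.1 x).1 (Icc m (N + n - m)) := by
  obtain ⟨s, hsS, hs⟩ := hS.edges x h0
  have hxs : EqOn x.1 s.1 (Ico 0 (n + 1 : ℕ)) := word_eq_word_iff.1 hs.symm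
  have hxs' : EqOn x.1 s.1 (Icc 0 (N + n)) := by
    have hext := eqOn_of_not_rightSpecial
      (hxs.mono fun k (hk : k ∈ Ico 1 (1 + (n : ℤ))) =>
        mem_Ico.2 ⟨by linarith [hk.1], by push_cast; linarith [hk.2]⟩) hx
    intro k ⟨hk0, hkN⟩
    rcases hk0.eq_or_lt with rfl | hk
    · exact hxs (mem_Ico.2 ⟨le_rfl, by positivity⟩)
    · exact hext ⟨hk, hkN⟩
  have hstart : EqOn (φ.1 x).1 (ψ.1 x).1 (Icc m (min (N + n - m) (n + 4 * m - 1))) := by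
    intro k ⟨hk, hk'⟩
    rw [hφ.1.eqOn hxs' ⟨by omega, by omega⟩, hψ.1.eqOn hxs' ⟨by omega, by omega⟩]
    exact h s hsS ⟨by omega, by omega⟩
  rcases lt_or_ge N (5 * m) with hN | hN
  · rwa [min_eq_left (by omega)] at hstart
  · rw [min_eq_right (by omega)] at hstart
    refine eqOn_aut_of_not_rightSpecial hφ
      (hstart.mono fun k hk => mem_Icc.2 ⟨hk.1, ?_⟩) fun j hj => hx j ⟨by have := hj.1; omega, hj.2⟩
    have := hk.2
    omega

variable [Finite A]

lemma IsTestSet.eq_of_mem_deterministicPoints (hS : IsTestSet n S) (hφ : φ ∈ autOfRange X m)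
    (h : ∀ s ∈ S, EqOn (φ.1 s).1 (ψ.1 s).1 (Ico 0 (n + 4 * m)))
    (hx : x ∈ deterministicPoints X n) : φ.1 x = ψ.1 x := by
  obtain ⟨k, hk⟩ := hS.orbits x hx
  have hkx := vadd_mem_deterministicPoints k hx
  set p := AddAction.period (1 : ℤ) (k +ᵥ x)
  have hp : 0 < (p : ℤ) := by exact_mod_cast period_pos_of_mem_deterministicPoints hkx
  have hper (g : Aut X) : Function.Periodic (g.1 (k +ᵥ x)).1 p := by
    rw [← vadd_eq_self_iff_periodic, ← aut_vadd, vadd_eq_self_iff_period_dvd.2 dvd_rfl]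
  have hagree : EqOn (φ.1 (k +ᵥ x)).1 (ψ.1 (k +ᵥ x)).1 (Ico 0 (p + p)) :=
    (eqOn_aut_of_not_rightSpecial (n := n) (b := p + p + m) hφ
      ((h _ hk).mono (Ico_subset_Ico_right (by omega))) fun j _ => hkx j).mono fun j hj =>
        mem_Icc.2 ⟨hj.1, by have := hj.2; omega⟩
  have heq : φ.1 (k +ᵥ x) = ψ.1 (k +ᵥ x) :=
    Subtype.ext (eq_of_periodic_of_eqOn_Ico hp hp (hper φ) (hper ψ) hagree)
  rwa [aut_vadd, aut_vadd, vadd_left_cancel_iff] at heq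

lemma IsTestSet.eq_of_forall_eqOn (hS : IsTestSet n S) (hm : 0 < m) (hmn : 2 * m ≤ n)
    (hφ : φ ∈ autOfRange X m) (hψ : ψ ∈ autOfRange X m)
    (h : ∀ s ∈ S, EqOn (φ.1 s).1 (ψ.1 s).1 (Ico 0 (n + 4 * m))) : φ = ψ := by
  refine aut_ext_zero fun x => ?_
  by_cases hrs : ∃ i ≤ -(m : ℤ), RightSpecial n (i +ᵥ x)
  · obtain ⟨i, ⟨him, hi⟩, hmax⟩ := Int.exists_greatest_of_bdd ⟨-m, fun _ h => h.1⟩ hrs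
    have hno : ∀ j ∈ Icc 1 (-m - i), ¬ RightSpecial n (j +ᵥ i +ᵥ x) := by
      intro j ⟨hj, hj'⟩ hji
      rw [vadd_vadd] at hji
      have := hmax _ ⟨by omega, hji⟩
      omega
    have := hS.eqOn_of_rightSpecial hm hφ hψ h hi hno
      (show -i ∈ Icc (m : ℤ) (-m - i + n - m) from ⟨by omega, by omega⟩)
    simpa [aut_vadd] using this
  · push Not at hrs
    rw [hS.eq_of_mem_deterministicPoints hφ h (mem_deterministicPoints_of_forall_le hrs)]

lemma IsTestSet.finite_autOfRange_and_ncard_le (hS : IsTestSet n S) (hfin : S.Finite) (hm : 0 < m)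
    (hmn : 2 * m ≤ n) : (autOfRange X m).Finite ∧
      (autOfRange X m).ncard ≤ complexity X (n + 4 * m) ^ S.ncard := by
  have := hfin.to_subtype
  let F (φ : autOfRange X m) (s : S) : languageOfLength X (n + 4 * m) :=
    ⟨word (n + 4 * m) (φ.1.1 s.1), range_word X _ ▸ mem_range_self _⟩
  have hF : F.Injective := fun φ ψ h => Subtype.ext <|
    hS.eq_of_forall_eqOn hm hmn φ.2 ψ.2 fun s hs => by
      simpa using word_eq_word_iff.1 (congrArg Subtype.val (congrFun h ⟨s, hs⟩))
  refine ⟨Finite.of_injective F hF, ?_⟩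
  simpa only [complexity, Nat.card_fun, Nat.card_coe_set_eq] using
    Nat.card_le_card_of_injective F hF

end TestSet

/-! ### The size of a test set -/

section Counting

lemma pow_clog_lt_mul {b k : ℕ} (hb : 1 < b) (hk : 1 < k) : b ^ Nat.clog b k < b * k := by
  obtain ⟨c, hc⟩ := Nat.exists_eq_succ_of_ne_zero (Nat.clog_pos hb hk).ne'
  have := Nat.pow_pred_clog_lt_self hb hk
  rw [hc, Nat.pred_succ] at this
  rw [hc, pow_succ', Nat.mul_lt_mul_left (by omega)]
  exact this

lemma exists_subset_injOn_orbit (G : Type*) {α : Type*} [AddGroup G] [AddAction G α] (U : Set α) :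
    ∃ T ⊆ U, InjOn (AddAction.orbit G) T ∧ ∀ x ∈ U, ∃ g : G, g +ᵥ x ∈ T := by
  obtain ⟨T, hTU, hT⟩ := (surjOn_image (AddAction.orbit G) U).exists_bijOn_subset
  refine ⟨T, hTU, hT.injOn, fun x hx => ?_⟩
  obtain ⟨t, htT, ht⟩ := hT.surjOn (mem_image_of_mem _ hx)
  obtain ⟨g, rfl⟩ := AddAction.orbit_eq_iff.1 ht
  exact ⟨g, htT⟩

variable {A : Type*} [TopologicalSpace A] {X : Subshift A ℤ} {n : ℕ}

lemma injOn_word_of_period_le (X : Subshift A ℤ) (q : ℕ) :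
    InjOn (word (2 * q)) {x : X.carrier | ∃ p : ℤ, 0 < p ∧ p ≤ q ∧ p +ᵥ x = x} := by
  rintro x ⟨p, hp, hpq, hpx⟩ y ⟨p', hp', hpq', hpy⟩ h
  refine Subtype.ext (eq_of_periodic_of_eqOn_Ico hp hp' (vadd_eq_self_iff_periodic.1 hpx)
    (vadd_eq_self_iff_periodic.1 hpy) ((word_eq_word_iff.1 h).mono ?_))
  exact Ico_subset_Ico_right (by push_cast; linarith)

lemma injOn_vadd_of_injOn_orbit {U : Set X.carrier} (horb : InjOn (AddAction.orbit ℤ) U) {q : ℕ}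
    (hq : ∀ x ∈ U, q ≤ AddAction.period (1 : ℤ) x) :
    InjOn (fun p : X.carrier × ℕ => (p.2 : ℤ) +ᵥ p.1) (U ×ˢ Iio q) := by
  rintro ⟨x, i⟩ ⟨hx, hi⟩ ⟨y, j⟩ ⟨hy, hj⟩ h
  simp only [mem_Iio] at hx hi hy hj h
  have hxy : AddAction.orbit ℤ x = AddAction.orbit ℤ y := by
    rw [← AddAction.orbit_vadd (i : ℤ) x, h, AddAction.orbit_vadd]
  obtain rfl := horb hx hy hxy
  have hfix : ((i : ℤ) - j) +ᵥ x = x := by rw [sub_eq_neg_add, ← vadd_vadd, h, neg_vadd_vadd]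
  have hzero := Int.eq_zero_of_abs_lt_dvd (vadd_eq_self_iff_period_dvd.1 hfix)
    (by have := hq x hx; rw [abs_lt]; omega)
  rw [show i = j by omega]

variable [Finite A]

lemma exists_finite_rightSpecial_subset (X : Subshift A ℤ) (n : ℕ) :
    ∃ R : Set X.carrier, R.Finite ∧
      (∀ x : X.carrier, RightSpecial n x → ∃ s ∈ R, word (n + 1) s = word (n + 1) x) ∧
      R.ncard + 2 * complexity X n ≤ 2 * complexity X (n + 1) := by
  obtain ⟨R, -, hR⟩ :=
    (surjOn_image (word (n + 1)) {x : X.carrier | RightSpecial n x}).exists_bijOn_subset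
  refine ⟨R, .of_injOn (mapsTo_univ _ _) hR.injOn finite_univ, fun x hx =>
    hR.surjOn (mem_image_of_mem _ hx), ?_⟩
  have h := ncard_nonunique_add_le (toFinite (languageOfLength X (n + 1)))
    fun w : Fin (n + 1) → A => (Fin.init w : Fin n → A)
  rw [init_image_languageOfLength] at h
  refine le_trans (Nat.add_le_add_right ?_ _) h
  rw [← hR.injOn.ncard_image, hR.image_eq]
  refine ncard_le_ncard ?_ (toFinite _)
  rintro _ ⟨x, ⟨y, hyx, hne⟩, rfl⟩
  rw [← range_word]
  exact ⟨mem_range_self x, _, mem_range_self y, hne, hyx⟩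

lemma ncard_mul_le_complexity {U V : Set X.carrier} (hUV : U ⊆ V)
    (hV : ∀ k : ℤ, MapsTo (fun x => k +ᵥ x) V V) (hword : InjOn (word n) V)
    (horb : InjOn (AddAction.orbit ℤ) U) {q : ℕ}
    (hq : ∀ x ∈ U, q ≤ AddAction.period (1 : ℤ) x) : U.ncard * q ≤ complexity X n := by
  have hsub : (fun p : X.carrier × ℕ => (p.2 : ℤ) +ᵥ p.1) '' (U ×ˢ Iio q) ⊆ V := by
    rintro _ ⟨⟨x, i⟩, ⟨hx, -⟩, rfl⟩
    exact hV i (hUV hx)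
  have hcard : (U ×ˢ Iio q).ncard = U.ncard * q := by
    simp [ncard_prod, ncard_eq_toFinset_card']
  rw [← hcard, ← (injOn_vadd_of_injOn_orbit horb hq).ncard_image]
  exact ncard_le_complexity_of_injOn (hword.mono hsub)

section Representatives

variable {T : Set X.carrier} (hT : T ⊆ deterministicPoints X n)
  (horb : InjOn (AddAction.orbit ℤ) T)

include hT horb

lemma ncard_le_period_mul_le_complexity (q : ℕ) :
    {x ∈ T | q ≤ AddAction.period (1 : ℤ) x}.ncard * q ≤ complexity X n :=
  ncard_mul_le_complexity ((sep_subset _ _).trans hT)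
    (fun k _ hx => vadd_mem_deterministicPoints k hx) (injOn_word_deterministicPoints X n)
    (horb.mono (sep_subset _ _)) fun _ hx => hx.2

lemma ncard_period_lt_mul_le_complexity (r q : ℕ) :
    {x ∈ T | r ≤ AddAction.period (1 : ℤ) x ∧ AddAction.period (1 : ℤ) x < q}.ncard * r ≤
      complexity X (2 * q) := by
  refine ncard_mul_le_complexity (fun x hx => ?_) ?_ (injOn_word_of_period_le X q)
    (horb.mono (sep_subset _ _)) fun _ hx => hx.2.1
  · have := period_pos_of_mem_deterministicPoints (hT hx.1)
    exact ⟨AddAction.period (1 : ℤ) x, by omega, by have := hx.2.2; omega,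
      vadd_eq_self_iff_period_dvd.2 dvd_rfl⟩
  · rintro k x ⟨p, hp, hpq, hpx⟩
    exact ⟨p, hp, hpq, by rw [vadd_comm, hpx]⟩

variable {m : ℕ} {η : ℝ} (h : ∀ q : ℕ, m ≤ q ^ 2 → (complexity X (8 * q) : ℝ) ≤ η * q ^ 2)

include h

lemma ncard_period_mem_Ico_two_pow_le {k : ℕ} (hk : m ≤ (2 ^ k) ^ 2) :
    ({x ∈ T | 2 ^ k ≤ AddAction.period (1 : ℤ) x ∧
      AddAction.period (1 : ℤ) x < 2 ^ (k + 1)}.ncard : ℝ) ≤ η * 2 ^ k := by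
  have hcard := (ncard_period_lt_mul_le_complexity hT horb (2 ^ k) (2 ^ (k + 1))).trans
    (complexity_mono (by rw [pow_succ]; omega : 2 * 2 ^ (k + 1) ≤ 8 * 2 ^ k))
  have hreal := (Nat.cast_le (α := ℝ).2 hcard).trans (h _ hk)
  push_cast at hreal
  exact le_of_mul_le_mul_right (hreal.trans_eq (by ring)) (by positivity : (0 : ℝ) < 2 ^ k)

lemma ncard_period_lt_two_pow_le {k : ℕ} (hk : m ≤ (2 ^ k) ^ 2) :
    ({x ∈ T | AddAction.period (1 : ℤ) x < 2 ^ k}.ncard : ℝ) ≤ η * (2 ^ k) ^ 2 := by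
  have hsub : {x ∈ T | AddAction.period (1 : ℤ) x < 2 ^ k} ⊆
      {x ∈ T | 1 ≤ AddAction.period (1 : ℤ) x ∧ AddAction.period (1 : ℤ) x < 2 ^ k} := fun x hx =>
    ⟨hx.1, period_pos_of_mem_deterministicPoints (hT hx.1), hx.2⟩
  have hfin : T.Finite := (finite_deterministicPoints X n).subset hT
  have hcard : {x ∈ T | AddAction.period (1 : ℤ) x < 2 ^ k}.ncard ≤ complexity X (8 * 2 ^ k) :=
    (ncard_le_ncard hsub (hfin.sep _)).trans <| (Nat.mul_one _).symm.trans_le <|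
      (ncard_period_lt_mul_le_complexity hT horb 1 (2 ^ k)).trans (complexity_mono (by omega))
  exact_mod_cast (Nat.cast_le (α := ℝ).2 hcard).trans (h _ hk)

lemma ncard_le_period_le {q : ℕ} (hm : 0 < m) (hnm : n ≤ 8 * m) (hq : m ≤ q) :
    ({x ∈ T | q ≤ AddAction.period (1 : ℤ) x}.ncard : ℝ) ≤ η * m := by
  have hcard := (ncard_le_period_mul_le_complexity hT horb q).trans (complexity_mono hnm)
  have hreal := (Nat.cast_le (α := ℝ).2 hcard).trans (h m (Nat.le_self_pow two_ne_zero m))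
  push_cast at hreal
  refine le_of_mul_le_mul_right ?_ (by positivity : (0 : ℝ) < m)
  calc _ ≤ ({x ∈ T | q ≤ AddAction.period (1 : ℤ) x}.ncard : ℝ) * q := by gcongr
    _ ≤ η * m ^ 2 := hreal
    _ = η * m * m := by ring

lemma ncard_orbitRepresentatives_le (hm : 1 < m) (hnm : n ≤ 8 * m) : (T.ncard : ℝ) ≤ 7 * η * m := by
  set per : X.carrier → ℕ := AddAction.period (1 : ℤ)
  have hfin : T.Finite := (finite_deterministicPoints X n).subset hT
  have hη : 0 ≤ η := nonneg_of_mul_nonneg_left ((Nat.cast_nonneg _).trans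
    (h m (Nat.le_self_pow two_ne_zero m))) (by positivity)
  -- Only the periods between `2 ^ a ≈ √m` and `2 ^ b ≈ m` have to be grouped dyadically.
  let a := Nat.clog 4 m
  let b := Nat.clog 2 m
  have hab : a ≤ b := Nat.clog_le_of_le_pow <|
    (Nat.le_pow_clog one_lt_two m).trans (Nat.pow_le_pow_left (by norm_num) _)
  have hfour (k : ℕ) : (2 ^ k) ^ 2 = 4 ^ k := by rw [← pow_mul, mul_comm, pow_mul]; norm_num
  have ha : m ≤ (2 ^ a) ^ 2 := (Nat.le_pow_clog (by norm_num) m).trans_eq (hfour a).symm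
  have ha' : ((2 : ℝ) ^ a) ^ 2 ≤ 4 * m := by
    exact_mod_cast (hfour a).trans_le (pow_clog_lt_mul (by norm_num) hm).le
  have hb' : (2 : ℝ) ^ b ≤ 2 * m := by exact_mod_cast (pow_clog_lt_mul one_lt_two hm).le
  have hshort := ncard_period_lt_two_pow_le hT horb h ha
  have hmiddle := ncard_lt_two_pow_le hfin (f := per) hab fun k hk =>
    ncard_period_mem_Ico_two_pow_le hT horb h <| ha.trans <|
      Nat.pow_le_pow_left (Nat.pow_le_pow_right two_pos hk) 2
  have hlong := ncard_le_period_le hT horb h (by omega) hnm (Nat.le_pow_clog one_lt_two m)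
  have hunion : (T.ncard : ℝ) ≤
      {x ∈ T | per x < 2 ^ b}.ncard + {x ∈ T | 2 ^ b ≤ per x}.ncard := by
    have hsub : T ⊆ {x ∈ T | per x < 2 ^ b} ∪ {x ∈ T | 2 ^ b ≤ per x} := fun x hx =>
      (lt_or_ge (per x) (2 ^ b)).imp (⟨hx, ·⟩) (⟨hx, ·⟩)
    exact_mod_cast (ncard_le_ncard hsub
      ((hfin.sep _).union (hfin.sep _))).trans (ncard_union_le _ _)
  calc (T.ncard : ℝ) ≤ η * (2 ^ a) ^ 2 + η * (2 ^ b - 2 ^ a) + η * m := by linarith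
    _ ≤ η * (4 * m) + η * (2 * m) + η * m := by
      gcongr
      linarith [pow_pos (two_pos (α := ℝ)) a]
    _ = 7 * η * m := by ring

end Representatives

lemma exists_isTestSet (X : Subshift A ℤ) (n : ℕ) :
    ∃ S : Set X.carrier, S.Finite ∧ IsTestSet n S ∧ ∀ {m : ℕ} {η : ℝ}, 1 < m → n ≤ 8 * m →
      (∀ q : ℕ, m ≤ q ^ 2 → (complexity X (8 * q) : ℝ) ≤ η * q ^ 2) →
      (S.ncard : ℝ) ≤ 2 * (complexity X (n + 1) - complexity X n : ℕ) + 7 * η * m := by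
  obtain ⟨R, hRfin, hR, hRcard⟩ := exists_finite_rightSpecial_subset X n
  obtain ⟨T, hTsub, horb, hT⟩ := exists_subset_injOn_orbit ℤ (deterministicPoints X n)
  refine ⟨R ∪ T, hRfin.union ((finite_deterministicPoints X n).subset hTsub),
    ⟨fun x hx => ?_, fun x hx => ?_⟩, fun {m η} hm hnm h => ?_⟩
  · obtain ⟨s, hs, hsx⟩ := hR x hx
    exact ⟨s, .inl hs, hsx⟩
  · obtain ⟨k, hk⟩ := hT x hx
    exact ⟨k, .inr hk⟩
  · have hRreal : (R.ncard : ℝ) ≤ 2 * (complexity X (n + 1) - complexity X n : ℕ) := by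
      exact_mod_cast (by omega : R.ncard ≤ 2 * (complexity X (n + 1) - complexity X n))
    have hTreal := ncard_orbitRepresentatives_le hTsub horb h hm hnm
    have hunion : ((R ∪ T).ncard : ℝ) ≤ R.ncard + T.ncard := by exact_mod_cast ncard_union_le R T
    linarith

end Counting

/-! ### The growth of the number of automorphisms of bounded range -/

section Growth

lemma exists_increment_mul_le {P : ℕ → ℕ} (hP : Monotone P) (a : ℕ) {m : ℕ} (hm : 0 < m) :
    ∃ n ∈ Ico a (a + m), (P (n + 1) - P n) * m ≤ P (a + m) := by
  by_contra! h
  have htelescope : ∑ i ∈ Finset.range m, (P (a + (i + 1)) - P (a + i)) = P (a + m) - P (a + 0) :=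
    Finset.sum_range_tsub (f := fun i => P (a + i)) (fun _ _ _ => hP (by omega)) m
  have hlt : ∑ _i ∈ Finset.range m, P (a + m) <
      ∑ i ∈ Finset.range m, (P (a + (i + 1)) - P (a + i)) * m :=
    Finset.sum_lt_sum_of_nonempty (Finset.nonempty_range_iff.2 hm.ne') fun i hi =>
      h (a + i) ⟨by omega, by have := Finset.mem_range.1 hi; omega⟩
  rw [← Finset.sum_mul, htelescope, Finset.sum_const, Finset.card_range, smul_eq_mul,
    mul_comm] at hlt
  exact hlt.not_ge (Nat.mul_le_mul_right m (Nat.sub_le _ _))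

lemma eventually_forall_le_mul_sq {P : ℕ → ℝ}
    (hP : P =o[atTop] fun n : ℕ => (n : ℝ) ^ 2 / Real.log n) {c : ℕ} (hc : 0 < c) {ε : ℝ}
    (hε : 0 < ε) : ∀ᶠ m : ℕ in atTop, ∀ q : ℕ, m ≤ q ^ 2 → P (c * q) ≤ ε / Real.log m * q ^ 2 := by
  obtain ⟨N, hN⟩ := eventually_atTop.1 (hP.def (c := ε / (2 * c ^ 2)) (by positivity))
  filter_upwards [eventually_ge_atTop ((N + 2) ^ 2)] with m hm q hmq
  have hq : N + 2 ≤ q := (Nat.pow_le_pow_iff_left two_ne_zero).1 (hm.trans hmq)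
  have hm0 : 0 < m := hm.trans_lt' (by positivity)
  have hlogm : 0 < Real.log m := Real.log_pos (by norm_cast; nlinarith)
  have hlog : Real.log m ≤ 2 * Real.log (c * q : ℕ) :=
    calc Real.log m ≤ Real.log ((c * q : ℕ) ^ 2) := by
          gcongr
          exact_mod_cast hmq.trans (Nat.pow_le_pow_left (Nat.le_mul_of_pos_left q hc) 2)
      _ = 2 * Real.log (c * q : ℕ) := by rw [Real.log_pow, Nat.cast_ofNat]
  have hbound := hN (c * q) ((by omega : N ≤ q).trans (Nat.le_mul_of_pos_left q hc))
  rw [Real.norm_of_nonneg (r := (_ / _ : ℝ)) (by positivity)] at hbound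
  calc P (c * q) ≤ ε / (2 * c ^ 2) * ((c * q : ℕ) ^ 2 / Real.log (c * q : ℕ)) :=
        (Real.le_norm_self _).trans hbound
    _ ≤ ε / (2 * c ^ 2) * ((c * q : ℕ) ^ 2 / (Real.log m / 2)) := by gcongr; linarith
    _ = ε / Real.log m * q ^ 2 := by push_cast; field_simp

variable {A : Type*} [Finite A] [TopologicalSpace A] {X : Subshift A ℤ}

lemma finite_autOfRange (X : Subshift A ℤ) (m : ℕ) : (autOfRange X m).Finite := by
  obtain ⟨S, hfin, hS, -⟩ := exists_isTestSet X (2 * (m + 1))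
  exact (hS.finite_autOfRange_and_ncard_le hfin m.succ_pos le_rfl).1.subset
    (autOfRange_mono m.le_succ)

section

variable {m : ℕ} {η : ℝ} (hm : 1 < m)
  (h : ∀ q : ℕ, m ≤ q ^ 2 → (complexity X (8 * q) : ℝ) ≤ η * q ^ 2)

include hm h

lemma exists_isTestSet_ncard_le :
    ∃ n ∈ Ico (2 * m) (3 * m), ∃ S : Set X.carrier, S.Finite ∧ IsTestSet n S ∧
      (S.ncard : ℝ) ≤ 9 * η * m := by
  obtain ⟨n, ⟨hn, hn'⟩, hinc⟩ := exists_increment_mul_le (complexity_mono (X := X)) (2 * m)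
    (by omega : 0 < m)
  obtain ⟨S, hfin, hS, hcard⟩ := exists_isTestSet X n
  refine ⟨n, ⟨hn, by omega⟩, S, hfin, hS, (hcard hm (by omega) h).trans ?_⟩
  have hincreal : ((complexity X (n + 1) - complexity X n : ℕ) : ℝ) * m ≤ η * m * m :=
    calc _ ≤ (complexity X (8 * m) : ℝ) := by
          exact_mod_cast hinc.trans (complexity_mono (by omega))
      _ ≤ η * m ^ 2 := h m (Nat.le_self_pow two_ne_zero m)
      _ = η * m * m := by ring
  linarith [le_of_mul_le_mul_right hincreal (by positivity)]

lemma log_ncard_autOfRange_le (hη : η ≤ 1) :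
    Real.log (autOfRange X m).ncard ≤ 18 * η * m * Real.log m := by
  obtain ⟨n, ⟨hn, hn'⟩, S, hfin, hS, hcard⟩ := exists_isTestSet_ncard_le hm h
  obtain ⟨hfinite, hle⟩ := hS.finite_autOfRange_and_ncard_le hfin (by omega) hn
  have hpos : 0 < (autOfRange X m).ncard := (ncard_pos hfinite).2 ⟨1, one_mem_autOfRange m⟩
  have hsq : (complexity X (n + 4 * m) : ℝ) ≤ (m : ℝ) ^ 2 :=
    calc (complexity X (n + 4 * m) : ℝ) ≤ complexity X (8 * m) := by
          exact_mod_cast complexity_mono (by omega)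
      _ ≤ η * m ^ 2 := h m (Nat.le_self_pow two_ne_zero m)
      _ ≤ (m : ℝ) ^ 2 := mul_le_of_le_one_left (by positivity) hη
  have hpow : ((autOfRange X m).ncard : ℝ) ≤ ((m : ℝ) ^ 2) ^ S.ncard :=
    calc ((autOfRange X m).ncard : ℝ) ≤ (complexity X (n + 4 * m) : ℝ) ^ S.ncard := by
          exact_mod_cast hle
      _ ≤ ((m : ℝ) ^ 2) ^ S.ncard := by gcongr
  calc Real.log (autOfRange X m).ncard ≤ Real.log (((m : ℝ) ^ 2) ^ S.ncard) :=
        Real.log_le_log (by exact_mod_cast hpos) hpow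
    _ = S.ncard * (2 * Real.log m) := by rw [Real.log_pow, Real.log_pow, Nat.cast_ofNat]
    _ ≤ 9 * η * m * (2 * Real.log m) := by gcongr
    _ = 18 * η * m * Real.log m := by ring

end

lemma isLittleO_log_ncard_autOfRange
    (hX : (fun n : ℕ => (complexity X n : ℝ)) =o[atTop] fun n : ℕ => (n : ℝ) ^ 2 / Real.log n) :
    (fun m => Real.log (autOfRange X m).ncard) =o[atTop] fun m : ℕ => (m : ℝ) := by
  refine IsLittleO.of_bound fun δ hδ => ?_
  have hlog : ∀ᶠ m : ℕ in atTop, δ / 18 ≤ Real.log m :=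
    (Real.tendsto_log_atTop.comp tendsto_natCast_atTop_atTop).eventually_ge_atTop _
  filter_upwards [eventually_forall_le_mul_sq hX (c := 8) (by norm_num)
    (by positivity : 0 < δ / 18), hlog, eventually_gt_atTop 1] with m hm hδm hm1
  have hlogpos : 0 < Real.log m := Real.log_pos (by exact_mod_cast hm1)
  rw [Real.norm_of_nonneg (Real.log_natCast_nonneg _), Real.norm_natCast]
  calc Real.log (autOfRange X m).ncard ≤ 18 * (δ / 18 / Real.log m) * m * Real.log m :=
        log_ncard_autOfRange_le hm1 hm ((div_le_one hlogpos).2 hδm)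
    _ = δ * m := by field_simp

end Growth

/-! ### Følner sequences from subexponential growth -/

section Folner

lemma exists_apply_add_le_add {u : ℕ → ℝ} (hu : u =o[atTop] fun m : ℕ => (m : ℝ)) {c : ℝ}
    (hc : 0 < c) (r N : ℕ) : ∃ m ≥ N, u (m + r) ≤ u m + c := by
  rcases r.eq_zero_or_pos with rfl | hr
  · exact ⟨N, le_rfl, by simpa using hc.le⟩
  by_contra! h
  have hgrow (t : ℕ) : u N + t * c ≤ u (N + r * t) := by
    induction t with
    | zero => simp
    | succ t ih =>
      have := h (N + r * t) (by omega)
      rw [add_assoc, ← Nat.mul_succ] at this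
      push_cast
      linarith
  have htend : Tendsto (fun t : ℕ => N + r * t) atTop atTop :=
    tendsto_atTop_mono (fun _ => Nat.le_add_left _ _) (tendsto_id.const_mul_atTop' hr)
  have hlinear : (fun t : ℕ => ((N + r * t : ℕ) : ℝ)) =O[atTop] fun t : ℕ => (t : ℝ) := by
    push_cast
    exact (isLittleO_const_id_atTop (N : ℝ) |>.comp_tendsto tendsto_natCast_atTop_atTop).isBigO.add
      (isBigO_const_mul_self _ _ _)
  have hsmall : (fun t : ℕ => u (N + r * t)) =o[atTop] fun t : ℕ => (t : ℝ) :=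
    (hu.comp_tendsto htend).trans_isBigO hlinear
  have hconst : (fun _ : ℕ => u N) =o[atTop] fun t : ℕ => (t : ℝ) :=
    (isLittleO_const_id_atTop _).comp_tendsto tendsto_natCast_atTop_atTop
  obtain ⟨t, ht, ht0⟩ :=
    (((hsmall.sub hconst).def (half_pos hc)).and (eventually_gt_atTop 0)).exists
  have ht0' : (0 : ℝ) < t := by exact_mod_cast ht0
  rw [Real.norm_natCast] at ht
  nlinarith [(Real.le_norm_self _).trans ht, hgrow t]

lemma exists_ncard_add_le {α : Type*} {H : ℕ → Set α} (hfin : ∀ m, (H m).Finite)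
    (hne : ∀ m, (H m).Nonempty)
    (hlog : (fun m => Real.log (H m).ncard) =o[atTop] fun m : ℕ => (m : ℝ)) {δ : ℝ} (hδ : 0 < δ)
    (r N : ℕ) : ∃ m ≥ N, ((H (m + r)).ncard : ℝ) ≤ (1 + δ) * (H m).ncard := by
  have hpos (m : ℕ) : (0 : ℝ) < (H m).ncard := by exact_mod_cast (ncard_pos (hfin m)).2 (hne m)
  obtain ⟨m, hm, hle⟩ := exists_apply_add_le_add hlog (Real.log_pos (by linarith : 1 < 1 + δ)) r N
  refine ⟨m, hm, (Real.log_le_log_iff (hpos _) (mul_pos (by linarith) (hpos _))).1 ?_⟩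
  rwa [Real.log_mul (by linarith) (hpos m).ne', add_comm (Real.log (1 + δ))]

variable {G : Type*} [Group G]

lemma ncard_symmDiff_smul_le {F F' : Set G} {g : G} {δ : ℝ} (hF' : F'.Finite) (hF : F ⊆ F')
    (hgF : g • F ⊆ F') (h : (F'.ncard : ℝ) ≤ (1 + δ) * F.ncard) :
    ((F ∆ (g • F)).ncard : ℝ) ≤ 2 * δ * F.ncard := by
  have hcard : ((F ∆ (g • F)).ncard : ℝ) + (F.ncard + F.ncard) ≤ 2 * F'.ncard := by
    have := ncard_symmDiff_add_ncard_add_ncard_le hF' hF hgF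
    rw [ncard_smul_set] at this
    exact_mod_cast this
  linarith

lemma isAmenable_of_isLittleO_log_ncard {H : ℕ → Set G} (hfin : ∀ m, (H m).Finite)
    (hone : ∀ m, 1 ∈ H m) (hcover : ∀ g, ∃ m, g ∈ H m)
    (hmul : ∀ {g h : G} {a b : ℕ}, g ∈ H a → h ∈ H b → g * h ∈ H (a + b))
    (hlog : (fun m => Real.log (H m).ncard) =o[atTop] fun m : ℕ => (m : ℝ)) :
    IsAmenable G := by
  have hmono : Monotone H := fun a b hab g hg => by
    simpa [Nat.add_sub_cancel' hab] using hmul hg (hone (b - a))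
  have hcountable : Countable G := by
    rw [← countable_univ_iff, ← iUnion_eq_univ_iff.2 hcover]
    exact countable_iUnion fun m => (hfin m).countable
  choose μ hμ hratio using fun k : ℕ => exists_ncard_add_le hfin (fun m => ⟨1, hone m⟩) hlog
    (Nat.one_div_pos_of_nat (α := ℝ) (n := k)) k k
  refine ⟨hcountable, fun k => H (μ k), fun k => hfin _, fun g => ?_, fun g => ?_⟩
  · obtain ⟨r, hr⟩ := hcover g
    filter_upwards [eventually_ge_atTop r] with k hk
    exact hmono (hk.trans (hμ k)) hr
  · obtain ⟨r, hr⟩ := hcover g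
    have hlim : Tendsto (fun k : ℕ => 2 * (1 / ((k : ℝ) + 1))) atTop (𝓝 0) := by
      simpa using tendsto_one_div_add_atTop_nhds_zero_nat.const_mul (2 : ℝ)
    refine squeeze_zero' (.of_forall fun k => by positivity) ?_ hlim
    filter_upwards [eventually_ge_atTop r] with k hk
    refine div_le_of_le_mul₀ (by positivity) (by positivity) <|
      ncard_symmDiff_smul_le (hfin _) (hmono (Nat.le_add_right _ _)) ?_ (hratio k)
    rintro _ ⟨f, hf, rfl⟩
    exact hmono (by omega) (hmul hr hf)

end Folner

lemma isBigO_sq_div_log_sq :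
    (fun n : ℕ => (n : ℝ) ^ 2 / Real.log n ^ 2) =O[atTop]
      fun n : ℕ => (n : ℝ) ^ 2 / Real.log n := by
  refine .of_bound' ?_
  filter_upwards [(Real.tendsto_log_atTop.comp tendsto_natCast_atTop_atTop).eventually_ge_atTop 1]
    with n hn
  simp only [Function.comp_apply] at hn
  rw [Real.norm_of_nonneg (by positivity), Real.norm_of_nonneg (by positivity)]
  gcongr
  exact le_self_pow₀ hn two_ne_zero

end SlowGrowth

theorem theorem1_general {A : Type*} [Finite A] [TopologicalSpace A] [DiscreteTopology A]
    (X : Subshift A ℤ)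
    (hX : (fun n : ℕ => (complexity X n : ℝ)) =o[atTop] fun n : ℕ => (n : ℝ) ^ 2 / Real.log n) :
    IsAmenable (Aut X) :=
  SlowGrowth.isAmenable_of_isLittleO_log_ncard
    (SlowGrowth.finite_autOfRange X) SlowGrowth.one_mem_autOfRange
    SlowGrowth.exists_mem_autOfRange SlowGrowth.mul_mem_autOfRange
    (SlowGrowth.isLittleO_log_ncard_autOfRange hX)

theorem theorem1 {A : Type*} [Finite A] [TopologicalSpace A] [DiscreteTopology A]
    (X : Subshift A ℤ)
    (hX : (fun n : ℕ => (complexity X n : ℝ)) =o[atTop]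
      fun n : ℕ => (n : ℝ) ^ 2 / (Real.log n) ^ 2) :
    IsAmenable (Aut X) :=
  theorem1_general X (hX.trans_isBigO SlowGrowth.isBigO_sq_div_log_sq)
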